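/- For $\gamma\in(0,\infty)$ and $x\in\mathbb{R}$ let $\gamma^x\in(0,\infty)$ be the real power, and for $\gamma\neq 1$ let $\log_\gamma:(0,\infty)\to\mathbb{R}$ be the inverse of $x\mapsto\gamma^x$. For $x\in(0,\infty)$ let $\ln x=\int_1^x\frac{dt}{t}$. 1. Let $f$ be a continuous monoid homomorphism from $(0,\infty)$ under multiplication to $\mathbb{R}$ under addition. Then $f(\gamma^x)=x\,f(\gamma)$ for all $x\in\mathbb{R}$ and $\gamma\in(0,\infty)$. If $\gamma\in(0,\infty)$ and $\gamma\neq1$, then $f(x)=f(\gamma)\log_\gamma x$ for all $x\in(0,\infty)$. 2. The map $\ln$ is a continuous monoid homomorphism from $((0,\infty),\times)$ to $(\mathbb{R},+)$. Consequently $\ln(\gamma^x)=x\ln\gamma$ for all $x\in\mathbb{R}$ and $\gamma\in(0,\infty)$, and $\ln x=\ln\gamma\,\log_\gamma x$ for all $x,\gamma\in(0,\infty)$ with $\gamma\neq1$. Moreover, there is a unique $e\in(0,\infty)$ with $\ln e=1$; it satisfies $e\neq1$, and $\ln=\log_e$. -/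

import Mathlib

/-- The space `(0,∞)` of positive reals: the subspace topology, and the monoid structure given by
multiplication. -/
abbrev PosReal : Type := {x : ℝ // 0 < x}

/-- Real exponentiation `γ ^ x`, for a positive base `γ` and a real exponent `x`, as a map into
`(0,∞)`. -/
noncomputable def expBase (γ : PosReal) (x : ℝ) : PosReal :=
  ⟨(γ : ℝ) ^ x, Real.rpow_pos_of_pos γ.2 x⟩

theorem expBase_bijective (γ : PosReal) (hγ : γ ≠ 1) : Function.Bijective (expBase γ) := by
  have h1 : (γ : ℝ) ≠ 1 := fun h => hγ (Subtype.ext h)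
  refine ⟨fun x y h => ?_, fun y => ⟨Real.logb γ y, Subtype.ext ?_⟩⟩
  · have h' : (γ : ℝ) ^ x = (γ : ℝ) ^ y := congrArg Subtype.val h
    rw [← Real.logb_rpow γ.2 h1 (x := x), h', Real.logb_rpow γ.2 h1]
  · exact Real.rpow_logb γ.2 h1 y.2

/-- The logarithm `log_γ : (0,∞) → ℝ` to a positive base `γ ≠ 1`: the inverse of `x ↦ γ ^ x`. -/
noncomputable def logBase (γ : PosReal) (hγ : γ ≠ 1) : PosReal → ℝ :=
  (Equiv.ofBijective (expBase γ) (expBase_bijective γ hγ)).symm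

/-- The natural logarithm, `ln x = ∫ t from 1 to x of dt / t` (for `x < 1` this is minus the
integral over `[x, 1]`). -/
noncomputable def natLog (x : PosReal) : ℝ :=
  ∫ t in (1 : ℝ)..(x : ℝ), 1 / t

/-- The integral that defines `natLog` is a genuine one. -/
theorem natLog_intervalIntegrable (x : PosReal) :
    IntervalIntegrable (fun t : ℝ => 1 / t) MeasureTheory.volume 1 (x : ℝ) :=
  intervalIntegral.intervalIntegrable_one_div
    (fun t ht h => by
      rw [h] at ht
      exact Set.notMem_uIcc_of_lt one_pos x.2 ht)
    continuousOn_id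

/-! For fixed `γ`, the map `x ↦ f (γ ^ x)` is additive and continuous on `ℝ`, hence `ℝ`-linear,
hence determined by its value `f γ` at `1`. Putting `log_γ x` for the exponent gives the second
formula. Both apply to `ln`, and the base with `ln e = 1` makes the factor `ln γ` disappear. -/

theorem expBase_add (γ : PosReal) (x y : ℝ) :
    expBase γ (x + y) = expBase γ x * expBase γ y :=
  Subtype.ext (Real.rpow_add γ.2 x y)

theorem expBase_zero (γ : PosReal) : expBase γ 0 = 1 :=
  Subtype.ext (Real.rpow_zero _)

theorem expBase_one (γ : PosReal) : expBase γ 1 = γ :=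
  Subtype.ext (Real.rpow_one _)

theorem continuous_expBase (γ : PosReal) : Continuous (expBase γ) :=
  Continuous.subtype_mk (Real.continuous_const_rpow γ.2.ne') _

theorem expBase_logBase (γ : PosReal) (hγ : γ ≠ 1) (x : PosReal) :
    expBase γ (logBase γ hγ x) = x :=
  (Equiv.ofBijective (expBase γ) (expBase_bijective γ hγ)).apply_symm_apply x

/-- The additive map `x ↦ f (γ ^ x)` attached to a homomorphism `f` and a base `γ`. -/
noncomputable def expBaseComp (f : PosReal →ₜ* Multiplicative ℝ) (γ : PosReal) : ℝ →+ ℝ where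
  toFun x := (f (expBase γ x)).toAdd
  map_zero' := by rw [expBase_zero, map_one, toAdd_one]
  map_add' x y := by rw [expBase_add, map_mul, toAdd_mul]

theorem continuousMonoidHom_expBase (f : PosReal →ₜ* Multiplicative ℝ) (γ : PosReal) (x : ℝ) :
    (f (expBase γ x)).toAdd = x * (f γ).toAdd := by
  have hc : Continuous (expBaseComp f γ) :=
    continuous_toAdd.comp (f.continuous_toFun.comp (continuous_expBase γ))
  -- Continuity upgrades additivity to real homogeneity, used on `x = x • 1`.
  have h := map_real_smul (expBaseComp f γ) hc x 1
  simpa [expBaseComp, expBase_one] using h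

theorem continuousMonoidHom_eq_mul_logBase (f : PosReal →ₜ* Multiplicative ℝ) (γ : PosReal)
    (hγ : γ ≠ 1) (x : PosReal) : (f x).toAdd = (f γ).toAdd * logBase γ hγ x := by
  conv_lhs => rw [← expBase_logBase γ hγ x]
  rw [continuousMonoidHom_expBase, mul_comm]

/-- Transfers the product rule, continuity and inversion by `Real.exp` to the integral. -/
theorem natLog_eq_log (x : PosReal) : natLog x = Real.log x := by
  rw [natLog, integral_one_div_of_pos one_pos x.2, div_one]

/-- The natural logarithm as a continuous homomorphism. -/
noncomputable def natLogHom : PosReal →ₜ* Multiplicative ℝ where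
  toFun x := Multiplicative.ofAdd (natLog x)
  map_one' := by
    rw [natLog_eq_log, Positive.val_one, Real.log_one, ofAdd_zero]
  map_mul' x y := by
    rw [← ofAdd_add, natLog_eq_log, natLog_eq_log, natLog_eq_log, Positive.val_mul,
      Real.log_mul x.2.ne' y.2.ne']
  continuous_toFun := by
    refine continuous_ofAdd.comp ?_
    rw [funext natLog_eq_log]
    exact continuous_subtype_val.log fun x => x.2.ne'

theorem natLog_eq_mul_logBase (γ : PosReal) (hγ : γ ≠ 1) (x : PosReal) :
    natLog x = natLog γ * logBase γ hγ x :=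
  -- `(natLogHom x).toAdd` is `natLog x` by definition.
  continuousMonoidHom_eq_mul_logBase natLogHom γ hγ x

theorem existsUnique_natLog_eq_one : ∃! e : PosReal, natLog e = 1 := by
  refine ⟨⟨Real.exp 1, Real.exp_pos 1⟩, ?_, fun y hy => Subtype.ext ?_⟩
  · simp only [natLog_eq_log, Real.log_exp]
  · have hy' : Real.log y = 1 := (natLog_eq_log y).symm.trans hy
    exact (Real.exp_log y.2).symm.trans (congrArg Real.exp hy')

theorem ne_one_of_natLog_eq_one (e : PosReal) (h : natLog e = 1) : e ≠ 1 := by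
  rintro rfl
  rw [natLog_eq_log, Positive.val_one, Real.log_one] at h
  exact zero_ne_one h

theorem proposition6p2 :
    -- every homomorphism of topological monoids from `((0,∞), ×)` to `(ℝ, +)`
    (∀ f : PosReal →ₜ* Multiplicative ℝ,
      (∀ (γ : PosReal) (x : ℝ), (f (expBase γ x)).toAdd = x * (f γ).toAdd) ∧
      (∀ (γ : PosReal) (hγ : γ ≠ 1) (x : PosReal),
        (f x).toAdd = (f γ).toAdd * logBase γ hγ x)) ∧
    -- `ln` is such a homomorphism
    (∃ f : PosReal →ₜ* Multiplicative ℝ, ∀ x : PosReal, (f x).toAdd = natLog x) ∧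
    (∀ (γ : PosReal) (x : ℝ), natLog (expBase γ x) = x * natLog γ) ∧
    (∀ (γ : PosReal) (hγ : γ ≠ 1) (x : PosReal), natLog x = natLog γ * logBase γ hγ x) ∧
    -- there is a unique `e` with `ln e = 1`; it is not `1`, and `ln = log_e`
    (∃! e : PosReal, natLog e = 1) ∧
    (∀ e : PosReal, natLog e = 1 → ∃ he : e ≠ 1, natLog = logBase e he) := by
  refine ⟨fun f => ⟨continuousMonoidHom_expBase f, continuousMonoidHom_eq_mul_logBase f⟩,
    ⟨natLogHom, fun _ => rfl⟩, continuousMonoidHom_expBase natLogHom, natLog_eq_mul_logBase,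
    existsUnique_natLog_eq_one, fun e he => ⟨ne_one_of_natLog_eq_one e he, funext fun x => ?_⟩⟩
  rw [natLog_eq_mul_logBase e (ne_one_of_natLog_eq_one e he), he, one_mul]
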